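/- Let $R$ be a commutative ring with identity. An ideal $I$ of $R$ is called dense if $(0:_R I)=\{r\in R : Ir=0\}$ is $0$, and semi-regular if it contains a finitely generated dense sub-ideal. An $R$-module $M$ is called semi-regular flat if $\mathrm{Tor}_1^R(R/I,M)=0$ for every finitely generated semi-regular ideal $I$ of $R$, and an $R$-module $N$ is called semi-regular cotorsion if $\mathrm{Ext}^1_R(M,N)=0$ for every semi-regular flat $R$-module $M$. Then the following statements are equivalent: 1. $R$ is a semisimple ring; 2. every semi-regular flat $R$-module is projective; 3. every $R$-module is semi-regular cotorsion. -/

import Mathlib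

universe u

open CategoryTheory

/-- An ideal `I` of a commutative ring `R` is dense if `(0 :_R I) = {r ∈ R | I r = 0}` is zero. -/
def Ideal.IsDenseIdeal {R : Type u} [CommRing R] (I : Ideal R) : Prop :=
  ∀ r : R, (∀ a ∈ I, a * r = 0) → r = 0

/-- An ideal is semi-regular if it contains a finitely generated dense sub-ideal. -/
def Ideal.IsSemiregular {R : Type u} [CommRing R] (I : Ideal R) : Prop :=
  ∃ J : Ideal R, J ≤ I ∧ J.FG ∧ J.IsDenseIdeal

/-- An `R`-module `M` is semi-regular flat if `Tor₁ᴿ(R ⧸ I, M) = 0` for every finitely generated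
semi-regular ideal `I` of `R`. -/
def IsSemiregularFlat (R : Type u) [CommRing R] (M : Type u) [AddCommGroup M] [Module R M] :
    Prop :=
  ∀ I : Ideal R, I.FG → I.IsSemiregular →
    Limits.IsZero (((Tor (ModuleCat.{u} R) 1).obj (ModuleCat.of R (R ⧸ I))).obj (ModuleCat.of R M))

/-- An `R`-module `N` is semi-regular cotorsion if `Ext¹_R(M, N) = 0` for every semi-regular flat
`R`-module `M`. -/
def IsSemiregularCotorsion (R : Type u) [CommRing R] (N : Type u) [AddCommGroup N] [Module R N] :
    Prop :=
  ∀ (M : Type u) [AddCommGroup M] [Module R M], IsSemiregularFlat R M →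
    Subsingleton (Abelian.Ext (ModuleCat.of R M) (ModuleCat.of R N) 1)

/-! The core is 2 ⇒ 1. Given a finitely generated dense ideal `I`, take a polynomial `f` whose
coefficients generate it. By McCoy's theorem `f` is a non-zero-divisor, so `R` embeds in `F =
R[X]_f`, which is flat over `R`, hence projective by 2, and `I F = F` since `f` is a unit in `F`. A
Nakayama argument on coordinates gives `r ∈ 1 + I` killing `1 : F`; so `r = 0` and `I = R`. The Tor
condition is then empty, every module is projective, and `R` is semisimple. 2 ⇔ 3 is the `Ext¹`
criterion for projectivity. -/

/-- The diagram chase for the vanishing of `Tor₁(N, M)`: given short exact sequences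
`0 → K → P → M → 0` and `0 → L → F → N → 0` with `M` and `F` flat, `N ⊗ K → N ⊗ P` is injective. -/
theorem Module.Flat.lTensor_injective_of_exact_of_exact {R K P M L F N : Type*} [CommRing R]
    [AddCommGroup K] [Module R K] [AddCommGroup P] [Module R P] [AddCommGroup M] [Module R M]
    [AddCommGroup L] [Module R L] [AddCommGroup F] [Module R F] [AddCommGroup N] [Module R N]
    [Module.Flat R M] [Module.Flat R F]
    {f : K →ₗ[R] P} {g : P →ₗ[R] M} {i : L →ₗ[R] F} {p : F →ₗ[R] N}
    (hf : Function.Injective f) (hfg : Function.Exact f g) (hg : Function.Surjective g)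
    (hi : Function.Injective i) (hip : Function.Exact i p) (hp : Function.Surjective p) :
    Function.Injective (f.lTensor N) := by
  refine (injective_iff_map_eq_zero _).2 fun x hx ↦ ?_
  obtain ⟨y, rfl⟩ := LinearMap.rTensor_surjective K hp x
  have h1 : p.rTensor P (f.lTensor F y) = 0 := by
    rw [← hx, ← LinearMap.comp_apply, ← LinearMap.comp_apply, LinearMap.rTensor_comp_lTensor,
      LinearMap.lTensor_comp_rTensor]
  obtain ⟨z, hz⟩ := (_root_.rTensor_exact P hip hp (f.lTensor F y)).1 h1
  have h2 : i.rTensor M (g.lTensor L z) = 0 := by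
    rw [← LinearMap.comp_apply, LinearMap.rTensor_comp_lTensor, ← LinearMap.lTensor_comp_rTensor,
      LinearMap.comp_apply, hz]
    exact (_root_.lTensor_exact F hfg hg).apply_apply_eq_zero y
  have h3 : g.lTensor L z = 0 :=
    (injective_iff_map_eq_zero (i.rTensor M)).1
      (Module.Flat.rTensor_preserves_injective_linearMap i hi) _ h2
  obtain ⟨w, rfl⟩ := (_root_.lTensor_exact L hfg hg z).1 h3
  -- Flatness of `F` lets this be tested after applying `F ⊗ f`; then `p ∘ i = 0` kills `y`.
  have h4 : i.rTensor K w = y := by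
    refine Module.Flat.lTensor_preserves_injective_linearMap (M := F) f hf ?_
    rw [← hz, ← LinearMap.comp_apply, ← LinearMap.comp_apply, LinearMap.rTensor_comp_lTensor,
      LinearMap.lTensor_comp_rTensor]
  rw [← h4]
  exact (_root_.rTensor_exact K hip hp).apply_apply_eq_zero w

/-- Tensoring with an arbitrary module preserves injectivity of `f` in a short exact sequence
`0 → K → P → M → 0` whose cokernel `M` is flat. -/
theorem Module.Flat.lTensor_injective_of_exact {R K P M : Type*} (N : Type*) [CommRing R]
    [AddCommGroup K] [Module R K] [AddCommGroup P] [Module R P] [AddCommGroup M] [Module R M]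
    [AddCommGroup N] [Module R N] [Module.Flat R M] {f : K →ₗ[R] P} {g : P →ₗ[R] M}
    (hf : Function.Injective f) (hfg : Function.Exact f g) (hg : Function.Surjective g) :
    Function.Injective (f.lTensor N) :=
  lTensor_injective_of_exact_of_exact hf hfg hg
    (Submodule.subtype_injective (LinearMap.ker (Finsupp.linearCombination R (id : N → N))))
    (LinearMap.exact_subtype_ker_map _) (Finsupp.linearCombination_id_surjective R N)

/-- `Tor₁(N, M)` vanishes if `N ⊗ -` preserves injectivity of the inclusions of kernels of
surjections onto `M`. -/
theorem ModuleCat.isZero_tor_one_of_lTensor_injective {R : Type u} [CommRing R]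
    (N M : ModuleCat.{u} R)
    (H : ∀ (P : Type u) [AddCommGroup P] [Module R P] (π : P →ₗ[R] M), Function.Surjective π →
      Function.Injective ((LinearMap.ker π).subtype.lTensor N)) :
    Limits.IsZero (((Tor (ModuleCat.{u} R) 1).obj N).obj M) := by
  let P := ProjectiveResolution.of M
  refine Limits.IsZero.of_iso ?_
    (P.isoLeftDerivedObj ((MonoidalCategory.tensoringLeft (ModuleCat.{u} R)).obj N) 1)
  refine (HomologicalComplex.exactAt_iff_isZero_homology _ _).1 ?_
  rw [HomologicalComplex.exactAt_iff' _ 2 1 0 (by simp) (by simp)]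
  have h1 := (ShortComplex.ShortExact.moduleCat_exact_iff_function_exact _).1 (P.exact_succ 0)
  have h0 := (ShortComplex.ShortExact.moduleCat_exact_iff_function_exact _).1 P.exact₀
  have hs : Function.Surjective (P.π.f 0).hom :=
    (ModuleCat.epi_iff_surjective _).1 inferInstance
  let d₁ : P.complex.X 1 →ₗ[R] P.complex.X 0 := (P.complex.d 1 0).hom
  let d₂ : P.complex.X 2 →ₗ[R] P.complex.X 1 := (P.complex.d 2 1).hom
  let π : P.complex.X 0 →ₗ[R] M := (P.π.f 0).hom
  let e : P.complex.X 1 →ₗ[R] LinearMap.ker π :=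
    d₁.codRestrict _ fun x ↦ h0.apply_apply_eq_zero x
  have hed : (LinearMap.ker π).subtype ∘ₗ e = d₁ := LinearMap.subtype_comp_codRestrict _ _ _
  have he : Function.Surjective e := fun ⟨x, hx⟩ ↦
    let ⟨y, hy⟩ := (h0 x).1 hx
    ⟨y, Subtype.ext hy⟩
  have hexact : Function.Exact d₂ e := fun x ↦ by
    rw [← h1 x, ← Submodule.coe_eq_zero]
    rfl
  have key : Function.Exact (d₂.lTensor N) (d₁.lTensor N) := by
    rw [← hed, LinearMap.lTensor_comp]
    exact (lTensor_exact N hexact he).comp_injective _ (H _ π hs) (map_zero _)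
  exact (ShortComplex.ShortExact.moduleCat_exact_iff_function_exact _).2 key

theorem isSemiregularFlat_of_flat (R : Type u) [CommRing R] (M : Type u) [AddCommGroup M]
    [Module R M] [Module.Flat R M] : IsSemiregularFlat R M := fun _ _ _ ↦
  ModuleCat.isZero_tor_one_of_lTensor_injective _ (ModuleCat.of R M) fun _ _ _ π hπ ↦
    Module.Flat.lTensor_injective_of_exact (M := M) _ (Submodule.subtype_injective _)
      (LinearMap.exact_subtype_ker_map π) hπ

theorem isSemiregularFlat_of_forall_eq_top {R : Type u} [CommRing R]
    (hR : ∀ I : Ideal R, I.FG → I.IsSemiregular → I = ⊤) (M : Type u) [AddCommGroup M]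
    [Module R M] : IsSemiregularFlat R M := fun I hI hI' ↦ by
  have : Subsingleton (R ⧸ I) := Ideal.Quotient.subsingleton_iff.2 (hR I hI hI')
  refine ModuleCat.isZero_tor_one_of_lTensor_injective _ _ fun P _ _ π hπ ↦ ?_
  exact Function.injective_of_subsingleton (α := TensorProduct R (R ⧸ I) (LinearMap.ker π)) _

/-- If `P` is projective and `I • P = P`, every element of `P` is killed by some element of
`1 + I`. -/
theorem Module.Projective.exists_sub_one_mem_and_smul_eq_zero {R P : Type*} [CommRing R]
    [AddCommGroup P] [Module R P] [Module.Projective R P] {I : Ideal R}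
    (hI : I • (⊤ : Submodule R P) = ⊤) (x : P) : ∃ r : R, r - 1 ∈ I ∧ r • x = 0 := by
  obtain ⟨s, hs⟩ := Module.projective_def'.1 ‹Module.Projective R P›
  have hs' (y : P) : Finsupp.linearCombination R id (s y) = y := LinearMap.congr_fun hs y
  have hmem (y j : P) : s y j ∈ I := by
    have h : (I • (⊤ : Submodule R P)).map (Finsupp.lapply j ∘ₗ s) ≤ I := by
      rw [Submodule.map_smul'']
      exact Submodule.smul_le.2 fun a ha b _ ↦ I.mul_mem_right b ha
    rw [hI] at h
    exact h ⟨y, Submodule.mem_top, rfl⟩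
  -- Applying `s` to `x = ∑ s x t • t` writes each coordinate of `s x` as a combination of all of
  -- them with coefficients in `I`, so Nakayama applies to `N`.
  let N : Ideal R := Ideal.span (s x '' (s x).support)
  have hN : N ≤ I • N := by
    refine Ideal.span_le.2 ?_
    rintro _ ⟨j, -, rfl⟩
    have hj : s x j = ∑ t ∈ (s x).support, s t j * s x t := by
      conv_lhs => rw [← hs' x]
      simp [Finsupp.linearCombination_apply, Finsupp.sum, Finsupp.finsetSum_apply, mul_comm]
    rw [SetLike.mem_coe, hj]
    exact Submodule.sum_mem _ fun t ht ↦
      Submodule.smul_mem_smul (hmem t j) (Ideal.subset_span ⟨t, ht, rfl⟩)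
  obtain ⟨r, hr, hrN⟩ := Submodule.exists_sub_one_mem_and_smul_eq_zero_of_fg_of_le_smul I N
    (Submodule.fg_span ((s x).support.finite_toSet.image _)) hN
  refine ⟨r, hr, ?_⟩
  have : r • s x = 0 := by
    ext j
    by_cases hj : j ∈ (s x).support
    · exact hrN _ (Ideal.subset_span ⟨j, hj, rfl⟩)
    · simp [Finsupp.notMem_support_iff.1 hj]
  rw [← hs' x, ← map_smul, this, map_zero]

/-- Every finitely generated ideal is generated by the coefficients of some polynomial. -/
theorem Ideal.FG.exists_polynomial_span_coeff_eq {R : Type*} [CommRing R] {I : Ideal R}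
    (hI : I.FG) : ∃ f : Polynomial R, Ideal.span (Set.range f.coeff) = I := by
  obtain ⟨n, a, rfl⟩ := Submodule.fg_iff_exists_fin_generating_family.1 hI
  refine ⟨∑ i : Fin n, Polynomial.monomial i (a i), le_antisymm ?_ ?_⟩
  · refine Ideal.span_le.2 ?_
    rintro _ ⟨k, rfl⟩
    rw [Polynomial.finsetSum_coeff]
    refine Submodule.sum_mem _ fun i _ ↦ ?_
    rw [Polynomial.coeff_monomial]
    split_ifs
    · exact Submodule.subset_span ⟨i, rfl⟩
    · exact Submodule.zero_mem _
  · refine Submodule.span_mono ?_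
    rintro _ ⟨i, rfl⟩
    refine ⟨i, ?_⟩
    simp [Polynomial.finsetSum_coeff, Polynomial.coeff_monomial, Fin.val_inj]

/-- If all flat `R`-modules are projective, a finitely generated dense ideal is the unit ideal. -/
theorem Ideal.IsDenseIdeal.eq_top {R : Type u} [CommRing R]
    (hR : ∀ (M : Type u) [AddCommGroup M] [Module R M], Module.Flat R M → Module.Projective R M)
    {I : Ideal R} (hI : I.FG) (hd : I.IsDenseIdeal) : I = ⊤ := by
  obtain ⟨f, rfl⟩ := hI.exists_polynomial_span_coeff_eq
  have hf : f ∈ nonZeroDivisors (Polynomial R) := by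
    refine Polynomial.mem_nonZeroDivisors_iff.2 fun r hr ↦ hd r fun a ha ↦ ?_
    induction ha using Submodule.span_induction with
    | mem _ h =>
      obtain ⟨n, rfl⟩ := h
      rw [mul_comm, ← smul_eq_mul, ← Polynomial.coeff_smul, hr, Polynomial.coeff_zero]
    | zero => exact zero_mul r
    | add _ _ _ _ h₁ h₂ => rw [add_mul, h₁, h₂, add_zero]
    | smul c _ _ h => rw [smul_eq_mul, mul_assoc, h, mul_zero]
  let F := Localization.Away f
  have : Module.Flat (Polynomial R) F := IsLocalization.flat F (Submonoid.powers f)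
  have : Module.Projective R F := hR F (Module.Flat.trans R (Polynomial R) F)
  have hIF : Ideal.span (Set.range f.coeff) • (⊤ : Submodule R F) = ⊤ := by
    refine eq_top_iff.2 fun y _ ↦ ?_
    have hy : algebraMap (Polynomial R) F f * (IsLocalization.Away.invSelf f * y) = y := by
      rw [← mul_assoc, IsLocalization.Away.mul_invSelf, one_mul]
    rw [← hy, ← Algebra.smul_def]
    generalize IsLocalization.Away.invSelf f * y = z
    -- Each term of `f • z` is a coefficient of `f` times `Xⁿ • z`, hence lies in `I F`.
    have hz : f • z =
        ∑ n ∈ Finset.range (f.natDegree + 1), Polynomial.monomial n (f.coeff n) • z := by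
      rw [← Finset.sum_smul, ← f.as_sum_range]
    rw [hz]
    refine Submodule.sum_mem _ fun n _ ↦ ?_
    rw [← mul_one (f.coeff n), ← smul_eq_mul, ← Polynomial.smul_monomial, smul_assoc]
    exact Submodule.smul_mem_smul (Ideal.subset_span ⟨n, rfl⟩) Submodule.mem_top
  obtain ⟨r, hr, hr1⟩ := Module.Projective.exists_sub_one_mem_and_smul_eq_zero hIF (1 : F)
  have hr0 : r = 0 := by
    have hinj : Function.Injective (algebraMap (Polynomial R) F) :=
      IsLocalization.injective F (Submonoid.powers_le.2 hf)
    refine Polynomial.C_injective (hinj ?_)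
    rw [map_zero, map_zero, ← hr1, Algebra.smul_def, mul_one, IsScalarTower.algebraMap_apply R
      (Polynomial R) F, Polynomial.algebraMap_eq]
  rw [Ideal.eq_top_iff_one]
  simpa [hr0] using hr

theorem isSemisimpleRing_of_forall_projective {R : Type u} [Ring R]
    (hR : ∀ (M : Type u) [AddCommGroup M] [Module R M], Module.Projective R M) :
    IsSemisimpleRing R := by
  refine (isSemisimpleModule_iff R R).2 ⟨fun I ↦ ?_⟩
  have := hR (R ⧸ I)
  obtain ⟨s, hs⟩ := LinearMap.exists_rightInverse_of_surjective I.mkQ I.range_mkQ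
  -- A section `s` of `R → R ⧸ I` yields a projection onto its range with kernel `I`.
  have h := (LinearMap.isCompl_of_proj (f := s.rangeRestrict ∘ₗ I.mkQ) ?_).symm
  · rw [LinearMap.ker_comp_of_ker_eq_bot, I.ker_mkQ] at h
    · exact ⟨LinearMap.range s, h⟩
    · rw [LinearMap.ker_rangeRestrict]
      exact LinearMap.ker_eq_bot_of_inverse hs
  · rintro ⟨_, y, rfl⟩
    exact Subtype.ext (congrArg s (LinearMap.congr_fun hs y))

theorem corollary3p3 (R : Type u) [CommRing R] :
    List.TFAE [
      IsSemisimpleRing R,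
      ∀ (M : Type u) [AddCommGroup M] [Module R M], IsSemiregularFlat R M → Module.Projective R M,
      ∀ (N : Type u) [AddCommGroup N] [Module R N], IsSemiregularCotorsion R N] := by
  tfae_have 1 → 2 := fun _ M _ _ _ ↦ Module.projective_of_isSemisimpleRing R M
  tfae_have 2 → 1 := fun h ↦ by
    have hR (I : Ideal R) (_ : I.FG) : I.IsSemiregular → I = ⊤ := fun ⟨J, hJI, hJ, hd⟩ ↦
      top_le_iff.1 <| (hd.eq_top (fun M _ _ _ ↦ h M (isSemiregularFlat_of_flat R M)) hJ).ge.trans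
        hJI
    exact isSemisimpleRing_of_forall_projective fun M _ _ ↦
      h M (isSemiregularFlat_of_forall_eq_top hR M)
  tfae_have 2 → 3 := fun h N _ _ M _ _ hM ↦ by
    have := (IsProjective.iff_projective M).1 (h M hM)
    have hext := projective_iff_subsingleton_ext_one.1 this
    exact @hext (ModuleCat.of R N)
  tfae_have 3 → 2 := fun h M _ _ hM ↦
    (IsProjective.iff_projective M).2 <| projective_iff_subsingleton_ext_one.2 fun N ↦
      h N M hM
  tfae_finish
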